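/- Let $\mathfrak{H}$ be a complex Hilbert space, let $H$ be a (possibly unbounded) self-adjoint operator on $\mathfrak{H}$ with domain $\mathrm{Dom}(H)$, and let $P_0$ be an orthogonal projection in $\mathfrak{H}$ such that $P_0\,\mathrm{Dom}(H)\subset\mathrm{Dom}(H)$. Assume that the commutator $[H,P_0]=HP_0-P_0H$ is bounded on $\mathrm{Dom}(H)$, that is, $$V_{H,P_0}:=\sup_{f\in\mathrm{Dom}(H),\ \|f\|=1}\|HP_0f-P_0Hf\|<\infty .$$ (If $\mathfrak{H}=\{0\}$, the supremum of the empty set is taken to be $0$.) For $t\in\mathbb{R}$ let $e^{-iHt}$ be the strongly continuous one-parameter unitary group generated by $-iH$, let $P_t=e^{-iHt}P_0e^{iHt}$, and let $\mathfrak{P}_t=\mathrm{Ran}(P_t)$. For closed subspaces $\mathfrak{Q},\mathfrak{R}\subset\mathfrak{H}$ with orthogonal projections $Q,R$ onto them, let $\vartheta(\mathfrak{Q},\mathfrak{R})=\arcsin\|Q-R\|$ be the maximal angle between $\mathfrak{Q}$ and $\mathfrak{R}$. Then $$\vartheta(\mathfrak{P}_s,\mathfrak{P}_t)=\arcsin\|P_t-P_s\|\le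 V_{H,P_0}\,|t-s|\qquad\text{for all } s,t\in\mathbb{R}.$$ -/

import Mathlib

namespace SubspaceEvolution

open Filter Topology

variable {E : Type*} [NormedAddCommGroup E] [InnerProductSpace ℂ E] [CompleteSpace E]

/-! ### Existence and uniqueness of the unitary group `exp (-i H t)`

Every self-adjoint, possibly unbounded, operator generates exactly one such group. -/

theorem mem_graph_iff_inner {H : E →ₗ.[ℂ] E} (hH : IsSelfAdjoint H) (x y : E) :
    (x, y) ∈ H.graph ↔ ∀ a b, (a, b) ∈ H.graph → inner ℂ b x = inner ℂ a y := by
  have h1 : H.graph = H.graph.adjoint := by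
    rw [← LinearPMap.adjoint_graph_eq_graph_adjoint hH.dense_domain,
      LinearPMap.isSelfAdjoint_def.mp hH]
  rw [h1, Submodule.mem_adjoint_iff, ← h1]
  simp only [sub_eq_zero]

theorem resolvent_bound {H : E →ₗ.[ℂ] E} (hH : IsSelfAdjoint H) (b : ℝ) {f g : E}
    (h : (f, g) ∈ H.graph) : |b| * ‖f‖ ≤ ‖g + (b * Complex.I) • f‖ := by
  have h1 : inner ℂ g f = inner ℂ f g := (mem_graph_iff_inner hH f g).1 h f g h
  have h2 : (inner ℂ f g : ℂ).im = 0 := by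
    have := congrArg Complex.im (inner_conj_symm g f)
    rw [h1] at this
    simp only [Complex.conj_im] at this
    linarith
  have h3 : (inner ℂ f (g + (b * Complex.I) • f) : ℂ).im = b * ‖f‖ ^ 2 := by
    rw [inner_add_right, inner_smul_right, inner_self_eq_norm_sq_to_K, Complex.add_im, h2]
    simp [← Complex.ofReal_pow]
  have h4 : |b| * ‖f‖ ^ 2 ≤ ‖f‖ * ‖g + (b * Complex.I) • f‖ := by
    calc |b| * ‖f‖ ^ 2 = |(inner ℂ f (g + (b * Complex.I) • f) : ℂ).im| := by
          rw [h3, abs_mul, abs_of_nonneg (sq_nonneg ‖f‖)]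
      _ ≤ ‖(inner ℂ f (g + (b * Complex.I) • f) : ℂ)‖ := Complex.abs_im_le_norm _
      _ ≤ _ := norm_inner_le_norm _ _
  rcases (norm_nonneg f).eq_or_lt with h5 | h5
  · rw [← h5]; simp
  · nlinarith

theorem exists_resolvent {H : E →ₗ.[ℂ] E} (hH : IsSelfAdjoint H) (b : ℝ) (hb : b ≠ 0) :
    ∃ R : E →L[ℂ] E, (∀ g, (R g, g - (b * Complex.I) • R g) ∈ H.graph) ∧
      (∀ f g, (f, g) ∈ H.graph → R (g + (b * Complex.I) • f) = f) ∧
      ∀ g, |b| * ‖R g‖ ≤ ‖g‖ := by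
  have hc : IsClosed (H.graph : Set (E × E)) := hH.isClosed
  let Φ : H.graph →L[ℂ] E :=
    ((ContinuousLinearMap.snd ℂ E E) + (b * Complex.I) • ContinuousLinearMap.fst ℂ E E).comp
      H.graph.subtypeL
  have hΦ : ∀ x : H.graph, Φ x = x.1.2 + (b * Complex.I) • x.1.1 := fun x => rfl
  have hb' : 0 < |b| := abs_pos.2 hb
  have hbd : ∀ x : H.graph, |b| * ‖x.1.1‖ ≤ ‖Φ x‖ := fun x => resolvent_bound hH b x.2
  have hanti : AntilipschitzWith (Real.toNNReal (|b|⁻¹ + 2)) Φ := by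
    apply ContinuousLinearMap.antilipschitz_of_bound
    intro x
    rw [Real.coe_toNNReal _ (by positivity)]
    have h1 := hbd x
    have h2 : ‖x.1.2‖ ≤ ‖Φ x‖ + |b| * ‖x.1.1‖ := by
      have : x.1.2 = Φ x - (b * Complex.I) • x.1.1 := by rw [hΦ]; abel
      calc ‖x.1.2‖ = ‖Φ x - (b * Complex.I) • x.1.1‖ := by rw [← this]
        _ ≤ ‖Φ x‖ + ‖(b * Complex.I) • x.1.1‖ := norm_sub_le _ _
        _ = _ := by rw [norm_smul]; simp
    have h3 : ‖x.1.1‖ ≤ |b|⁻¹ * ‖Φ x‖ := by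
      rw [inv_mul_eq_div, le_div_iff₀ hb']; linarith
    have h4 : 0 ≤ |b|⁻¹ * ‖Φ x‖ := by positivity
    have h5 := norm_nonneg (Φ x)
    calc ‖x‖ = max ‖x.1.1‖ ‖x.1.2‖ := rfl
      _ ≤ _ := max_le (by nlinarith) (by nlinarith)
  have : CompleteSpace H.graph := hc.completeSpace_coe
  have hrc : IsClosed (Set.range Φ) := hanti.isClosed_range Φ.uniformContinuous
  have hsurj : Φ.range = ⊤ := by
    have : CompleteSpace Φ.range := IsClosed.completeSpace_coe (s := (Set.range Φ)) (hs := hrc)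
    rw [← Submodule.orthogonal_eq_bot_iff, Submodule.eq_bot_iff]
    intro x hx
    have h1 : (x, (b * Complex.I) • x) ∈ H.graph := by
      rw [mem_graph_iff_inner hH]
      intro f g hfg
      have := (Submodule.mem_orthogonal _ _).1 hx (g + (b * Complex.I) • f) ⟨⟨(f, g), hfg⟩, rfl⟩
      rw [inner_add_left, inner_smul_left] at this
      rw [inner_smul_right]
      simp only [map_mul, Complex.conj_ofReal, Complex.conj_I] at this
      linear_combination this
    have h2 := resolvent_bound hH (-b) h1
    simp only [Complex.ofReal_neg, neg_mul, neg_smul, add_neg_cancel, norm_zero, abs_neg] at h2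
    have : ‖x‖ ≤ 0 := by
      by_contra h; push Not at h
      nlinarith [mul_pos hb' h]
    exact norm_le_zero_iff.1 this
  have hker : Φ.ker = ⊥ := LinearMap.ker_eq_bot.2 hanti.injective
  let e := ContinuousLinearEquiv.ofBijective Φ hker hsurj
  have he : ∀ g, Φ (e.symm g) = g := fun g => ContinuousLinearEquiv.ofBijective_apply_symm_apply _ _ _ g
  refine ⟨((ContinuousLinearMap.fst ℂ E E).comp H.graph.subtypeL).comp e.symm.toContinuousLinearMap,
    ?_, ?_, ?_⟩
  · intro g
    have h1 : g - (b * Complex.I) • (e.symm g).1.1 = (e.symm g).1.2 := by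
      have h2 := hΦ (e.symm g)
      rw [he] at h2
      nth_rewrite 1 [h2]
      abel
    change ((e.symm g).1.1, g - (b * Complex.I) • (e.symm g).1.1) ∈ H.graph
    rw [h1]
    exact (e.symm g).2
  · intro f g hfg
    have h1 : e.symm (Φ ⟨(f, g), hfg⟩) = ⟨(f, g), hfg⟩ := 
      ContinuousLinearEquiv.ofBijective_symm_apply_apply _ _ _ _
    change (e.symm (Φ ⟨(f, g), hfg⟩)).1.1 = f
    rw [h1]
  · intro g
    have := hbd (e.symm g)
    rw [he] at this
    exact this

theorem exists_approx {H : E →ₗ.[ℂ] E} (hH : IsSelfAdjoint H) :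
    ∃ A : ℕ → E →L[ℂ] E, (∀ n, IsSelfAdjoint (A n)) ∧ (∀ n m, Commute (A n) (A m)) ∧
      ∀ f g, (f, g) ∈ H.graph → Tendsto (fun n => A n f) atTop (𝓝 g) := by
  choose R hR1 hR2 hR3 using exists_resolvent hH
  have hcomm : ∀ a b ha hb, Commute (R a ha) (R b hb) := by
    intro a b ha hb
    have key : ∀ (a b : ℝ) ha hb f, R a ha f + (((a : ℂ) - b) * Complex.I) • R a ha (R b hb f) = R b hb f := by
      intro a b ha hb f
      have := hR2 a ha _ _ (hR1 b hb f)
      rw [← map_smul, ← map_add]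
      refine Eq.trans ?_ this
      congr 1
      module
    by_cases hab : a = b
    · subst hab; exact Commute.refl _
    · ext f
      have h1 := key a b ha hb f
      have h2 := key b a hb ha f
      have h3 : ((a - b) * Complex.I) • (R a ha (R b hb f) - R b hb (R a ha f)) = 0 := by
        rw [smul_sub]
        have : (((b:ℂ) - a) * Complex.I) = - ((a - b) * Complex.I) := by ring
        rw [this, neg_smul] at h2
        generalize ((a - b) * Complex.I) • R a ha (R b hb f) = u at *
        generalize ((a - b) * Complex.I) • R b hb (R a ha f) = v at *
        have h4 : u - v = (R a ha f + u) + (R b hb f + -v) - R a ha f - R b hb f := by abel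
        rw [h4, h1, h2]; abel
      have h4 : ((a - b) * Complex.I : ℂ) ≠ 0 := by
        apply mul_ne_zero _ Complex.I_ne_zero
        rw [sub_ne_zero]; exact_mod_cast hab
      exact sub_eq_zero.1 ((smul_eq_zero.1 h3).resolve_left h4)
  have hadj : ∀ b hb hb', star (R b hb) = R (-b) hb' := by
    intro b hb hb'
    rw [ContinuousLinearMap.star_eq_adjoint]
    symm
    rw [ContinuousLinearMap.eq_adjoint_iff]
    intro x y
    have h1 := (mem_graph_iff_inner hH _ _).1 (hR1 b hb y) _ _ (hR1 (-b) hb' x)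
    rw [inner_sub_left, inner_sub_right, inner_smul_left, inner_smul_right] at h1
    simp only [map_mul, Complex.conj_I, Complex.ofReal_neg, map_neg, Complex.conj_ofReal] at h1
    linear_combination -h1
  have hp : ∀ n : ℕ, (n + 1 : ℝ) ≠ 0 := fun n => by positivity
  have hm : ∀ n : ℕ, -(n + 1 : ℝ) ≠ 0 := fun n => neg_ne_zero.2 (hp n)
  -- convergence of `bi R_b` to the identity for `|b| → ∞`
  have hK : ∀ (b : ℕ → ℝ) (hb : ∀ n, b n ≠ 0), Tendsto (fun n => |b n|) atTop atTop →
      ∀ x, Tendsto (fun n => (b n * Complex.I) • R (b n) (hb n) x) atTop (𝓝 x) := by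
    intro b hb hlim x
    have hn : ∀ n y, ‖(b n * Complex.I) • R (b n) (hb n) y‖ ≤ ‖y‖ := by
      intro n y
      rw [norm_smul]; simpa using hR3 (b n) (hb n) y
    rw [Metric.tendsto_atTop]
    intro ε hε
    obtain ⟨f, hf, hfx⟩ := Metric.mem_closure_iff.1 (hH.dense_domain x) (ε / 3) (by positivity)
    set g := H ⟨f, hf⟩ with hg
    have hfg : (f, g) ∈ H.graph := H.mem_graph ⟨f, hf⟩
    obtain ⟨N, hN⟩ := eventually_atTop.1 (hlim.eventually (eventually_gt_atTop (3 * ‖g‖ / ε)))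
    refine ⟨N, fun n hnN => ?_⟩
    have hb' : 0 < |b n| := abs_pos.2 (hb n)
    have h1 : ‖(b n * Complex.I) • R (b n) (hb n) f - f‖ < ε / 3 := by
      have h2 := hR2 (b n) (hb n) f g hfg
      rw [map_add, map_smul] at h2
      have h3 : (b n * Complex.I) • R (b n) (hb n) f - f = - R (b n) (hb n) g := by
        rw [sub_eq_iff_eq_add, neg_add_eq_sub, eq_sub_iff_add_eq, add_comm]
        exact h2
      rw [h3, norm_neg]
      have h4 := hR3 (b n) (hb n) g
      have h5 := hN n hnN
      rw [div_lt_iff₀ hε] at h5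
      by_contra h6
      push Not at h6
      nlinarith
    rw [dist_eq_norm] at hfx ⊢
    have h2 := hn n (x - f)
    rw [map_sub, smul_sub] at h2
    have e : (b n * Complex.I) • R (b n) (hb n) x - x =
      ((b n * Complex.I) • R (b n) (hb n) x - (b n * Complex.I) • R (b n) (hb n) f) +
      ((b n * Complex.I) • R (b n) (hb n) f - f) - (x - f) := by abel
    rw [e]
    refine (norm_sub_le _ _).trans_lt ?_
    have h3 := norm_add_le ((b n * Complex.I) • R (b n) (hb n) x - (b n * Complex.I) • R (b n) (hb n) f)
      ((b n * Complex.I) • R (b n) (hb n) f - f)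
    linarith
  have hlim : Tendsto (fun n : ℕ => |(n + 1 : ℝ)|) atTop atTop := by
    apply tendsto_abs_atTop_atTop.comp
    exact tendsto_atTop_add_const_right _ _ tendsto_natCast_atTop_atTop
  have hlim' : Tendsto (fun n : ℕ => |-(n + 1 : ℝ)|) atTop atTop := by
    simpa only [abs_neg] using hlim
  let c : ℕ → ℝ := fun n => (n + 1) ^ 2 / 2
  refine ⟨fun n => c n • (R (n + 1) (hp n) + R (-(n + 1)) (hm n)), ?_, ?_, ?_⟩
  · intro n
    have h1 := hadj (n + 1) (hp n) (hm n)
    have h2 : star (R (-(n + 1)) (hm n)) = R (n + 1) (hp n) := by rw [← h1, star_star]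
    rw [IsSelfAdjoint, star_smul, star_add, h1, h2, add_comm]
    simp
  · intro n m
    apply Commute.smul_left
    apply Commute.smul_right
    exact ((hcomm _ _ _ _).add_right (hcomm _ _ _ _)).add_left
      ((hcomm _ _ _ _).add_right (hcomm _ _ _ _))
  · intro f g hfg
    have h1 := ((hK _ hp hlim g).add (hK _ hm hlim' g)).const_smul (1 / 2 : ℝ)
    have h2 : (1 / 2 : ℝ) • (g + g) = g := by module
    rw [h2] at h1
    refine h1.congr fun n => ?_
    have key : ∀ b hb, R b hb g = f - (b * Complex.I) • R b hb f := by
      intro b hb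
      have h2 := hR2 b hb f g hfg
      rw [map_add, map_smul] at h2
      exact eq_sub_of_add_eq h2
    rw [key, key]
    simp only [smul_apply, add_apply, smul_sub, smul_add, smul_smul,
      ← Complex.coe_smul, c]
    match_scalars <;> ring_nf <;> simp [Complex.I_sq] <;> ring

/-- The norm-continuous group `exp (-i t A)` of a bounded operator `A`; only used in the existence
proof below. -/
noncomputable def boundedGroup (A : E →L[ℂ] E) (t : ℝ) : E →L[ℂ] E :=
  NormedSpace.exp (t • (-Complex.I • A))

theorem boundedGroup_norm {A : E →L[ℂ] E} (hA : IsSelfAdjoint A) (t : ℝ) (f : E) :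
    ‖boundedGroup A t f‖ = ‖f‖ := by
  have h : IsSelfAdjoint ((-t) • A) := by
    rw [IsSelfAdjoint, star_smul, hA.star_eq]; simp
  have h1 : boundedGroup A t = (selfAdjoint.expUnitary ⟨(-t) • A, h⟩ : E →L[ℂ] E) := by
    rw [selfAdjoint.expUnitary_coe, boundedGroup]
    congr 1
    simp only [smul_comm t, neg_smul, smul_neg]
  rw [h1]
  exact Unitary.norm_map _ f

theorem boundedGroup_hasDerivAt (A : E →L[ℂ] E) (t : ℝ) (f : E) :
    HasDerivAt (fun t => boundedGroup A t f) (boundedGroup A t (-Complex.I • A f)) t := by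
  have h := hasDerivAt_exp_smul_const (𝕂 := ℝ) (-Complex.I • A) t
  exact ((ContinuousLinearMap.apply ℂ E f).restrictScalars ℝ).hasFDerivAt.comp_hasDerivAt t h

theorem boundedGroup_zero (A : E →L[ℂ] E) : boundedGroup A 0 = 1 := by
  simp [boundedGroup]

theorem boundedGroup_add (A : E →L[ℂ] E) (s t : ℝ) :
    boundedGroup A (s + t) = boundedGroup A s * boundedGroup A t := by
  let +nondep : NormedAlgebra ℚ (E →L[ℂ] E) := .restrictScalars ℚ ℂ (E →L[ℂ] E)
  rw [boundedGroup, add_smul, NormedSpace.exp_add_of_commute]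
  · rfl
  · exact ((Commute.refl _).smul_left _).smul_right _

theorem boundedGroup_sub_self {A : E →L[ℂ] E} (hA : IsSelfAdjoint A) (t : ℝ) (f : E) :
    ‖boundedGroup A t f - f‖ ≤ |t| * ‖A f‖ := by
  have h := Convex.norm_image_sub_le_of_norm_hasDerivWithin_le (C := ‖A f‖) (x := 0) (y := t)
    (s := Set.univ) (fun s _ => (boundedGroup_hasDerivAt A s f).hasDerivWithinAt)
    (fun s _ => by rw [boundedGroup_norm hA, norm_smul]; simp) convex_univ trivial trivial
  rw [boundedGroup_zero, sub_zero, Real.norm_eq_abs, mul_comm] at h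
  exact h

theorem boundedGroup_sub {A B : E →L[ℂ] E} (hA : IsSelfAdjoint A) (hB : IsSelfAdjoint B)
    (hAB : Commute A B) (t : ℝ) (f : E) :
    ‖boundedGroup A t f - boundedGroup B t f‖ ≤ |t| * ‖A f - B f‖ := by
  have h : boundedGroup A t = boundedGroup B t * boundedGroup (A - B) t := by
    let +nondep : NormedAlgebra ℚ (E →L[ℂ] E) := .restrictScalars ℚ ℂ (E →L[ℂ] E)
    rw [boundedGroup, boundedGroup, boundedGroup, ← NormedSpace.exp_add_of_commute]
    · congr 1; module
    · have : Commute B (A - B) := hAB.symm.sub_right (Commute.refl _)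
      exact (((this.smul_left _).smul_left _).smul_right _).smul_right _
  rw [h, mul_apply_eq_comp, ← map_sub, boundedGroup_norm hB]
  exact boundedGroup_sub_self (hA.sub hB) t f

/-- `U` is the strongly continuous one-parameter unitary group `t ↦ exp (-i H t)`: its infinitesimal
generator is exactly `-i H`, i.e. `f ∈ Dom H` and `H f = g` if and only if `t ↦ U t f` is
differentiable at `0` with derivative `-i g`. -/
structure IsUnitaryGroupOf (H : E →ₗ.[ℂ] E) (U : ℝ → E →L[ℂ] E) : Prop where
  mem_unitary : ∀ t, U t ∈ unitary (E →L[ℂ] E)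
  map_zero : U 0 = 1
  map_add : ∀ s t, U (s + t) = U s * U t
  continuous : ∀ f, Continuous fun t => U t f
  mem_graph_iff : ∀ f g, (f, g) ∈ H.graph ↔ HasDerivAt (fun t => U t f) (-Complex.I • g) 0

theorem exists_isUnitaryGroupOf {H : E →ₗ.[ℂ] E} (hH : IsSelfAdjoint H) :
    ∃ U : ℝ → E →L[ℂ] E, IsUnitaryGroupOf H U := by
  obtain ⟨A, hA, hAc, hAlim⟩ := exists_approx hH
  have hcau : ∀ t f, CauchySeq fun n => boundedGroup (A n) t f := by
    intro t f
    rw [Metric.cauchySeq_iff]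
    intro ε hε
    obtain ⟨f', hf', hff⟩ := Metric.mem_closure_iff.1 (hH.dense_domain f) (ε / 3) (by positivity)
    rw [dist_eq_norm] at hff
    have h1 := (hAlim f' _ (H.mem_graph ⟨f', hf'⟩)).cauchySeq
    obtain ⟨N, hN⟩ := Metric.cauchySeq_iff.1 h1 (ε / 3 / (|t| + 1)) (by positivity)
    refine ⟨N, fun m hm n hn => ?_⟩
    have h2 := boundedGroup_sub (hA m) (hA n) (hAc m n) t f'
    have h3 := hN m hm n hn
    rw [dist_eq_norm, lt_div_iff₀ (by positivity)] at h3
    rw [dist_eq_norm]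
    have e : boundedGroup (A m) t f - boundedGroup (A n) t f =
      boundedGroup (A m) t (f - f') + (boundedGroup (A m) t f' - boundedGroup (A n) t f')
        - boundedGroup (A n) t (f - f') := by simp only [map_sub]; abel
    rw [e]
    have h4 := norm_add_le (boundedGroup (A m) t (f - f'))
      (boundedGroup (A m) t f' - boundedGroup (A n) t f')
    have h5 := norm_sub_le (boundedGroup (A m) t (f - f') +
      (boundedGroup (A m) t f' - boundedGroup (A n) t f')) (boundedGroup (A n) t (f - f'))
    rw [boundedGroup_norm (hA _)] at h4 h5
    have := norm_nonneg (A m f' - A n f')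
    nlinarith
  have hex : ∀ t f, ∃ y, Tendsto (fun n => boundedGroup (A n) t f) atTop (𝓝 y) :=
    fun t f => cauchySeq_tendsto_of_complete (hcau t f)
  choose u hu using hex
  let U : ℝ → E →L[ℂ] E := fun t => continuousLinearMapOfTendsto (fun n => boundedGroup (A n) t)
    (tendsto_pi_nhds.2 (hu t))
  have hU : ∀ t f, Tendsto (fun n => boundedGroup (A n) t f) atTop (𝓝 (U t f)) := hu
  have hnorm : ∀ t f, ‖U t f‖ = ‖f‖ := fun t f =>
    tendsto_nhds_unique (hU t f).norm (by simp only [boundedGroup_norm (hA _)]; exact tendsto_const_nhds)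
  have hzero : U 0 = 1 := by
    ext f
    refine tendsto_nhds_unique (hU 0 f) ?_
    simp only [boundedGroup_zero]
    exact tendsto_const_nhds
  have hadd : ∀ s t, U (s + t) = U s * U t := by
    intro s t
    ext f
    refine tendsto_nhds_unique (hU (s + t) f) ?_
    simp only [boundedGroup_add, mul_apply_eq_comp]
    have h1 : Tendsto (fun n => boundedGroup (A n) s (boundedGroup (A n) t f - U t f)) atTop (𝓝 0) := by
      rw [tendsto_zero_iff_norm_tendsto_zero]
      simp only [boundedGroup_norm (hA _)]
      rw [← tendsto_zero_iff_norm_tendsto_zero]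
      simpa using (hU t f).sub_const (U t f)
    simpa using h1.add (hU s (U t f))
  have hself : ∀ f g, (f, g) ∈ H.graph → ∀ t, ‖U t f - f‖ ≤ |t| * ‖g‖ := fun f g hfg t =>
    le_of_tendsto_of_tendsto' ((hU t f).sub_const f).norm ((hAlim f g hfg).norm.const_mul |t|)
      fun n => boundedGroup_sub_self (hA n) t f
  have hinner : ∀ t x y, inner ℂ (U t x) (U t y) = inner ℂ x y := fun t =>
    ((U t).inner_map_map_iff_adjoint_comp_self).2
      (((U t).norm_map_iff_adjoint_comp_self).1 (hnorm t))
  have hderiv : ∀ f g, (f, g) ∈ H.graph → HasDerivAt (fun t => U t f) (-Complex.I • g) 0 := by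
    intro f g hfg
    rw [hasDerivAt_iff_isLittleO, Asymptotics.isLittleO_iff]
    intro c hc
    obtain ⟨n, hn⟩ := (Metric.tendsto_atTop.1 (hAlim f g hfg) (c / 3) (by positivity))
    have hn := hn n le_rfl
    rw [dist_eq_norm] at hn
    have h1 := boundedGroup_hasDerivAt (A n) 0 f
    rw [hasDerivAt_iff_isLittleO, Asymptotics.isLittleO_iff] at h1
    filter_upwards [h1 (c := c / 3) (by positivity)] with t ht
    have h2 : ‖U t f - boundedGroup (A n) t f‖ ≤ |t| * ‖g - A n f‖ :=
      le_of_tendsto_of_tendsto' ((hU t f).sub_const _).norm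
        (((hAlim f g hfg).sub_const (A n f)).norm.const_mul |t|)
        fun m => boundedGroup_sub (hA m) (hA n) (hAc m n) t f
    simp only [boundedGroup_zero, hzero, sub_zero, one_apply_eq_self] at ht ⊢
    rw [norm_sub_rev] at hn
    have e : U t f - f - t • -Complex.I • g = (U t f - boundedGroup (A n) t f) +
      (boundedGroup (A n) t f - f - t • -Complex.I • A n f) - t • -Complex.I • (g - A n f) := by
      rw [smul_sub, smul_sub]; abel
    rw [e]
    have h3 : ‖t • -Complex.I • (g - A n f)‖ = |t| * ‖g - A n f‖ := by
      rw [norm_smul, norm_smul]; simp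
    have h4 := norm_sub_le ((U t f - boundedGroup (A n) t f) +
      (boundedGroup (A n) t f - f - t • -Complex.I • A n f)) (t • -Complex.I • (g - A n f))
    have h5 := norm_add_le (U t f - boundedGroup (A n) t f)
      (boundedGroup (A n) t f - f - t • -Complex.I • A n f)
    rw [Real.norm_eq_abs] at ht ⊢
    nlinarith [abs_nonneg t]
  refine ⟨U, ⟨fun t => ?_, hzero, hadd, fun f => ?_, fun f g => ⟨hderiv f g, fun h => ?_⟩⟩⟩
  · have h1 : star (U t) * U t = 1 := ((U t).norm_map_iff_adjoint_comp_self).1 (hnorm t)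
    have h2 : U t * U (-t) = 1 := by rw [← hadd, add_neg_cancel, hzero]
    have h3 : star (U t) = U (-t) := left_inv_eq_right_inv h1 h2
    exact Unitary.mem_iff.2 ⟨h1, by rw [h3, h2]⟩
  · have hdiff : ∀ s t x, ‖U t x - U s x‖ = ‖U (t - s) x - x‖ := by
      intro s t x
      rw [← hnorm s (U (t - s) x - x), map_sub, ← mul_apply_eq_comp, ← hadd]
      simp
    rw [Metric.continuous_iff]
    intro s ε hε
    obtain ⟨f', hf', hff⟩ := Metric.mem_closure_iff.1 (hH.dense_domain f) (ε / 3) (by positivity)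
    rw [dist_eq_norm] at hff
    set g := H ⟨f', hf'⟩
    have hg : (f', g) ∈ H.graph := H.mem_graph ⟨f', hf'⟩
    refine ⟨ε / 3 / (‖g‖ + 1), by positivity, fun t ht => ?_⟩
    rw [dist_eq_norm, Real.norm_eq_abs, lt_div_iff₀ (by positivity)] at ht
    rw [dist_eq_norm, hdiff]
    have h1 := hself f' g hg (t - s)
    have e : U (t - s) f - f = U (t - s) (f - f') + (U (t - s) f' - f') - (f - f') := by
      rw [map_sub]; abel
    have h2 := norm_add_le (U (t - s) (f - f')) (U (t - s) f' - f')
    have h3 := norm_sub_le (U (t - s) (f - f') + (U (t - s) f' - f')) (f - f')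
    rw [hnorm] at h2
    rw [e]
    nlinarith [abs_nonneg (t - s)]
  · rw [mem_graph_iff_inner hH]
    intro a b hab
    have h1 := (hderiv a b hab).inner ℂ h
    simp only [hinner, hzero] at h1
    have h2 := h1.unique (hasDerivAt_const (0 : ℝ) (inner ℂ a f))
    simp only [one_apply_eq_self, inner_smul_left, inner_smul_right, map_neg,
      Complex.conj_I, neg_neg] at h2
    have h3 : Complex.I * (inner ℂ b f - inner ℂ a g) = 0 := by linear_combination h2
    exact sub_eq_zero.1 ((mul_eq_zero.1 h3).resolve_left Complex.I_ne_zero)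

theorem IsUnitaryGroupOf.hasDerivAt {H : E →ₗ.[ℂ] E} {U : ℝ → E →L[ℂ] E}
    (hU : IsUnitaryGroupOf H U) {f g : E} (h : (f, g) ∈ H.graph) (t : ℝ) :
    (U t f, U t g) ∈ H.graph ∧ HasDerivAt (fun t => U t f) (-Complex.I • U t g) t := by
  have h0 := (hU.mem_graph_iff f g).1 h
  have h1 : HasDerivAt (fun s => U t (U s f)) (U t (-Complex.I • g)) 0 :=
    ((U t).restrictScalars ℝ).hasFDerivAt.comp_hasDerivAt 0 h0
  rw [map_smul] at h1
  constructor
  · rw [hU.mem_graph_iff]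
    convert h1 using 2 with s
    rw [← mul_apply_eq_comp, ← mul_apply_eq_comp, ← hU.map_add,
      ← hU.map_add, add_comm]
  · have h2 := HasDerivAt.comp_sub_const t t (f := fun s => U t (U s f)) (by rw [sub_self]; exact h1)
    convert h2 using 2 with s
    rw [← mul_apply_eq_comp, ← hU.map_add, add_sub_cancel]

theorem IsUnitaryGroupOf.unique {H : E →ₗ.[ℂ] E} (hH : IsSelfAdjoint H)
    {U V : ℝ → E →L[ℂ] E} (hU : IsUnitaryGroupOf H U) (hV : IsUnitaryGroupOf H V) : U = V := by
  funext t
  have key : ∀ f ∈ H.domain, U t f = V t f := by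
    intro f hf
    have hg := H.mem_graph ⟨f, hf⟩
    have hd : ∀ s, HasDerivAt (fun s => inner ℂ (U s f) (V s f)) 0 s := by
      intro s
      obtain ⟨h1, h2⟩ := hU.hasDerivAt hg s
      obtain ⟨h3, h4⟩ := hV.hasDerivAt hg s
      have h5 := (mem_graph_iff_inner hH _ _).1 h3 _ _ h1
      have h6 := h2.inner ℂ h4
      rw [inner_smul_left, inner_smul_right, h5, map_neg, Complex.conj_I, neg_neg, neg_mul,
        neg_add_cancel] at h6
      exact h6
    have h1 := is_const_of_deriv_eq_zero (fun s => (hd s).differentiableAt) (fun s => (hd s).deriv) t 0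
    simp only [hU.map_zero, hV.map_zero, one_apply_eq_self] at h1
    have hUn := ContinuousLinearMap.norm_map_of_mem_unitary (hU.mem_unitary t) f
    have hVn := ContinuousLinearMap.norm_map_of_mem_unitary (hV.mem_unitary t) f
    have h2 := norm_sub_sq (𝕜 := ℂ) (U t f) (V t f)
    rw [h1, hUn, hVn, inner_self_eq_norm_sq] at h2
    have h3 : ‖U t f - V t f‖ ^ 2 = 0 := by rw [h2]; ring
    exact sub_eq_zero.1 (norm_eq_zero.1 (pow_eq_zero_iff two_ne_zero |>.1 h3))
  exact ContinuousLinearMap.ext fun x =>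
    congrFun ((U t).continuous.ext_on hH.dense_domain (V t).continuous key) x

/-- The unitary `exp (-i H t)`: the value at `t` of the unique strongly continuous unitary group
generated by `-i H`. -/
noncomputable def propagator (H : E →ₗ.[ℂ] E) (hH : IsSelfAdjoint H) (t : ℝ) : E →L[ℂ] E :=
  Classical.choose (exists_isUnitaryGroupOf hH) t

theorem isUnitaryGroupOf_propagator {H : E →ₗ.[ℂ] E} (hH : IsSelfAdjoint H) :
    IsUnitaryGroupOf H (propagator H hH) :=
  Classical.choose_spec (exists_isUnitaryGroupOf hH)

/-- `P_t = exp (-i H t) P₀ exp (i H t)`. -/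
noncomputable def evolvedProjection (H : E →ₗ.[ℂ] E) (hH : IsSelfAdjoint H) (P₀ : E →L[ℂ] E)
    (t : ℝ) : E →L[ℂ] E :=
  propagator H hH t * P₀ * propagator H hH (-t)

theorem isStarProjection_evolvedProjection {H : E →ₗ.[ℂ] E} (hH : IsSelfAdjoint H)
    {P₀ : E →L[ℂ] E} (hP₀ : IsStarProjection P₀) (t : ℝ) :
    IsStarProjection (evolvedProjection H hH P₀ t) := by
  have hU := isUnitaryGroupOf_propagator hH
  have h1 : propagator H hH t * propagator H hH (-t) = 1 := by
    rw [← hU.map_add, add_neg_cancel, hU.map_zero]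
  have h2 : propagator H hH (-t) * propagator H hH t = 1 := by
    rw [← hU.map_add, neg_add_cancel, hU.map_zero]
  have h3 : star (propagator H hH t) = propagator H hH (-t) :=
    left_inv_eq_right_inv (Unitary.mem_iff.1 (hU.mem_unitary t)).1 h1
  have h4 : star (propagator H hH (-t)) = propagator H hH t := by rw [← h3, star_star]
  have hp : P₀ * P₀ = P₀ := hP₀.isIdempotentElem
  constructor
  · change propagator H hH t * P₀ * propagator H hH (-t) *
      (propagator H hH t * P₀ * propagator H hH (-t)) = propagator H hH t * P₀ * propagator H hH (-t)
    calc _ = propagator H hH t * P₀ * (propagator H hH (-t) * propagator H hH t) * P₀ *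
          propagator H hH (-t) := by simp only [mul_assoc]
      _ = propagator H hH t * (P₀ * P₀) * propagator H hH (-t) := by
          rw [h2, mul_one]; simp only [mul_assoc]
      _ = _ := by rw [hp]
  · rw [IsSelfAdjoint, evolvedProjection, star_mul, star_mul, h3, h4, hP₀.isSelfAdjoint.star_eq,
      mul_assoc]

/-- The closed subspace `𝔓_t = Ran P_t`. -/
noncomputable def evolvedSubspace (H : E →ₗ.[ℂ] E) (hH : IsSelfAdjoint H) (P₀ : E →L[ℂ] E)
    (hP₀ : IsStarProjection P₀) (t : ℝ) : ClosedSubmodule ℂ E where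
  toSubmodule := (evolvedProjection H hH P₀ t).range
  isClosed' :=
    ContinuousLinearMap.IsIdempotentElem.isClosed_range
      (isStarProjection_evolvedProjection hH hP₀ t).isIdempotentElem

/-- The maximal angle `ϑ(𝔔, ℜ) = arcsin ‖Q - R‖` between two closed subspaces, where `Q` and `R` are
the orthogonal projections onto them. -/
noncomputable def maximalAngle (Q R : ClosedSubmodule ℂ E) : ℝ :=
  Real.arcsin ‖Q.toSubmodule.starProjection - R.toSubmodule.starProjection‖

/-- The commutator `[H, P] = H P - P H` of a possibly unbounded operator `H` with a bounded operator
`P` defined on the whole space, with domain `{f ∈ Dom H | P f ∈ Dom H}`. -/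
noncomputable def commutatorPMap (H : E →ₗ.[ℂ] E) (P : E →L[ℂ] E) : E →ₗ.[ℂ] E where
  domain := H.domain ⊓ H.domain.comap (P : E →ₗ[ℂ] E)
  toFun :=
    { toFun := fun f => H ⟨P f, f.2.2⟩ - P (H ⟨f, f.2.1⟩)
      map_add' := fun f g => by
        have h1 : (⟨P (f + g : E), (f + g).2.2⟩ : H.domain) = ⟨P f, f.2.2⟩ + ⟨P g, g.2.2⟩ :=
          Subtype.ext (map_add P (f : E) g)
        have h2 : (⟨(f + g : E), (f + g).2.1⟩ : H.domain) = ⟨f, f.2.1⟩ + ⟨g, g.2.1⟩ := rfl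
        change H ⟨P (f + g : E), (f + g).2.2⟩ - P (H ⟨(f + g : E), (f + g).2.1⟩) = _
        rw [h1, h2, H.map_add, H.map_add, map_add]
        abel
      map_smul' := fun c f => by
        have h1 : (⟨P (c • f : E), (c • f).2.2⟩ : H.domain) = c • ⟨P f, f.2.2⟩ :=
          Subtype.ext (map_smul P c (f : E))
        have h2 : (⟨(c • f : E), (c • f).2.1⟩ : H.domain) = c • ⟨f, f.2.1⟩ := rfl
        change H ⟨P (c • f : E), (c • f).2.2⟩ - P (H ⟨(c • f : E), (c • f).2.1⟩) = _
        rw [h1, h2, H.map_smul, H.map_smul, map_smul, ← smul_sub]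
        rfl }

/-- The values `‖T f‖` on unit vectors `f ∈ Dom T`. -/
def unitValues (T : E →ₗ.[ℂ] E) : Set ℝ :=
  {r | ∃ f : T.domain, ‖(f : E)‖ = 1 ∧ r = ‖T f‖}

/-- `V_{H,P₀}`, the supremum of `‖H P₀ f - P₀ H f‖` over the unit vectors of the domain. -/
noncomputable def commutatorNorm (H : E →ₗ.[ℂ] E) (P₀ : E →L[ℂ] E) : ℝ :=
  sSup (unitValues (commutatorPMap H P₀))

end SubspaceEvolution

open SubspaceEvolution

/-! For `f ∈ Dom H` the path `t ↦ P_t f` is differentiable with derivative `-i e^{-iHt} [H, P₀]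
e^{iHt} f`, of norm at most `V ‖f‖`. The mean value inequality and density of the domain give `‖P_t
- P_s‖ ≤ V |t - s|` (`norm_evolvedProjection_sub_le`).

Taking arcsin of this yields only `arcsin (V |t - s|)`, which is too weak, but it is sharp to first
order. The maximal angle satisfies the triangle inequality (`arcsin_norm_sub_le_add`), so cutting
the interval into `n` equal steps bounds the angle by `n * arcsin (V |t - s| / n)`, which tends to
`V |t - s|`.

The triangle inequality reduces to angles between vectors: `x ∈ Ran P` makes an angle at most
`arcsin ‖P - Q‖` with `Q x`, which makes an angle at most `arcsin ‖Q - R‖` with `R (Q x)`. This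
controls `(1 - R) P`, by symmetry also `(1 - P) R`, and these two control `P - R`. -/

namespace SubspaceEvolution

open Filter Topology

/-! ### The commutator bound -/

section Commutator

variable {E : Type*} [NormedAddCommGroup E] [InnerProductSpace ℂ E]

theorem norm_commutatorPMap_le {H : E →ₗ.[ℂ] E} {P : E →L[ℂ] E}
    (hbdd : BddAbove (unitValues (commutatorPMap H P))) (f : (commutatorPMap H P).domain) :
    ‖commutatorPMap H P f‖ ≤ commutatorNorm H P * ‖(f : E)‖ := by
  rcases eq_or_ne (f : E) 0 with h | h
  · have : f = 0 := Subtype.ext h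
    rw [this, LinearPMap.map_zero]; simp
  · have h1 : ‖(f : E)‖ ≠ 0 := norm_ne_zero_iff.2 h
    have h2 : ‖f‖⁻¹ * ‖commutatorPMap H P f‖ ≤ commutatorNorm H P := by
      apply le_csSup hbdd
      refine ⟨((‖f‖⁻¹ : ℝ) : ℂ) • f, ?_, ?_⟩
      · rw [Submodule.coe_smul, norm_smul, Complex.norm_real, norm_inv, norm_norm]
        exact inv_mul_cancel₀ h1
      · rw [LinearPMap.map_smul, norm_smul, Complex.norm_real, norm_inv, norm_norm]
    rwa [inv_mul_le_iff₀ (by positivity), mul_comm] at h2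

/-- `Real.sSup` is 0 on empty and on unbounded sets, so no boundedness or nontriviality of the space
enters. -/
theorem commutatorNorm_nonneg (H : E →ₗ.[ℂ] E) (P : E →L[ℂ] E) : 0 ≤ commutatorNorm H P :=
  Real.sSup_nonneg fun _ ⟨_, _, hr⟩ => hr ▸ norm_nonneg _

end Commutator

/-! ### Angles between a vector and its projections -/

section Angle

variable {E : Type*} [NormedAddCommGroup E] [InnerProductSpace ℂ E] [CompleteSpace E]

theorem inner_starProjection_right {Q : E →L[ℂ] E} (hQ : IsStarProjection Q) (x y : E) :
    inner ℂ x (Q y) = inner ℂ (Q x) y := by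
  rw [← ContinuousLinearMap.adjoint_inner_left, ← ContinuousLinearMap.star_eq_adjoint,
    hQ.isSelfAdjoint.star_eq]

theorem starProjection_apply_apply {Q : E →L[ℂ] E} (hQ : IsStarProjection Q) (x : E) :
    Q (Q x) = Q x :=
  DFunLike.congr_fun hQ.isIdempotentElem x

theorem inner_starProjection_self {Q : E →L[ℂ] E} (hQ : IsStarProjection Q) (x : E) :
    inner ℂ x (Q x) = ((‖Q x‖ ^ 2 : ℝ) : ℂ) := by
  rw [← starProjection_apply_apply hQ, inner_starProjection_right hQ,
    starProjection_apply_apply hQ, inner_self_eq_norm_sq_to_K]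
  simp

theorem norm_sq_sub_starProjection {Q : E →L[ℂ] E} (hQ : IsStarProjection Q) (x : E) :
    ‖x - Q x‖ ^ 2 = ‖x‖ ^ 2 - ‖Q x‖ ^ 2 := by
  rw [norm_sub_sq (𝕜 := ℂ), inner_starProjection_self hQ]
  simp only [RCLike.re_to_complex, Complex.ofReal_re]
  ring

/-- Pythagoras: `x - Q x = (P - Q) x` has norm at most `‖P - Q‖ ‖x‖`, and what remains of `‖x‖²` is
`‖Q x‖²`. -/
theorem cos_arcsin_mul_norm_le {P Q : E →L[ℂ] E} (hQ : IsStarProjection Q)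
    {x : E} (hx : P x = x) : Real.cos (Real.arcsin ‖P - Q‖) * ‖x‖ ≤ ‖Q x‖ := by
  have h1 : ‖x - Q x‖ ≤ ‖P - Q‖ * ‖x‖ := by
    have := (P - Q).le_opNorm x
    rwa [sub_apply, hx] at this
  have h2 := norm_sq_sub_starProjection hQ x
  have h3 : ‖x - Q x‖ ^ 2 ≤ (‖P - Q‖ * ‖x‖) ^ 2 := by gcongr
  rw [Real.cos_arcsin]
  rcases le_total 0 (1 - ‖P - Q‖ ^ 2) with h | h
  · apply le_of_sq_le_sq _ (norm_nonneg _)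
    rw [mul_pow, Real.sq_sqrt h]
    nlinarith
  · rw [Real.sqrt_eq_zero_of_nonpos h, zero_mul]
    exact norm_nonneg _

-- Angles are those of the underlying real space, whose inner product is the real part of the
-- complex one.
attribute [local instance] InnerProductSpace.complexToReal

theorem angle_starProjection_le {P Q : E →L[ℂ] E} (hQ : IsStarProjection Q)
    {x : E} (hx : P x = x) (hx0 : x ≠ 0) :
    InnerProductGeometry.angle x (Q x) ≤ Real.arcsin ‖P - Q‖ := by
  have h1 := cos_arcsin_mul_norm_le hQ hx
  have hx' : 0 < ‖x‖ := norm_pos_iff.2 hx0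
  rw [InnerProductGeometry.angle, ← Real.arccos_cos (Real.arcsin_nonneg.2 (norm_nonneg (P - Q)))
    ((Real.arcsin_le_pi_div_two _).trans (by linarith [Real.pi_pos]))]
  apply Real.arccos_le_arccos
  have h2 : (inner ℝ x (Q x) : ℝ) = ‖Q x‖ ^ 2 := by
    change (inner ℂ x (Q x)).re = _
    rw [inner_starProjection_self hQ, Complex.ofReal_re]
  rw [h2]
  -- If `Q x = 0`, the quotient is 0 by convention, and `h1` forces the cosine to be nonpositive.
  rcases (norm_nonneg (Q x)).eq_or_lt with h | h
  · rw [← h] at h1 ⊢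
    simpa using nonpos_of_mul_nonpos_left h1 hx'
  · rw [le_div_iff₀ (by positivity)]
    nlinarith

/-- The angle from `x` to `R (Q x)`, a vector of `Ran R`, is at most the sum of the two arcsines. No
nonzero vector of `Ran R` is closer in angle to `x` than `R x`, so the cosine of the sum bounds `‖R
x‖` from below. -/
theorem norm_sub_starProjection_le_sin {P Q R : E →L[ℂ] E} (hQ : IsStarProjection Q)
    (hR : IsStarProjection R)
    (h : Real.arcsin ‖P - Q‖ + Real.arcsin ‖Q - R‖ < Real.pi / 2) {x : E} (hx : P x = x) :
    ‖x - R x‖ ≤ Real.sin (Real.arcsin ‖P - Q‖ + Real.arcsin ‖Q - R‖) * ‖x‖ := by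
  rcases eq_or_ne x 0 with rfl | hx0
  · simp
  set a := Real.arcsin ‖P - Q‖ with ha
  set b := Real.arcsin ‖Q - R‖ with hb
  have ha0 : 0 ≤ a := Real.arcsin_nonneg.2 (norm_nonneg _)
  have hb0 : 0 ≤ b := Real.arcsin_nonneg.2 (norm_nonneg _)
  have hpi := Real.pi_pos
  have hx' : 0 < ‖x‖ := norm_pos_iff.2 hx0
  -- Both angles are below `π / 2`, so neither projection kills the vector and the angles below are
  -- genuine.
  have hy : 0 < ‖Q x‖ := lt_of_lt_of_le
    (mul_pos (Real.cos_pos_of_mem_Ioo ⟨by linarith, by linarith⟩) hx') (cos_arcsin_mul_norm_le hQ hx)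
  have hQx := starProjection_apply_apply hQ x
  have hz : 0 < ‖R (Q x)‖ := lt_of_lt_of_le
    (mul_pos (Real.cos_pos_of_mem_Ioo ⟨by linarith, by linarith⟩) hy) (cos_arcsin_mul_norm_le hR hQx)
  have h1 : InnerProductGeometry.angle x (R (Q x)) ≤ a + b :=
    (InnerProductGeometry.angle_le_angle_add_angle x (Q x) (R (Q x))).trans
      (add_le_add (angle_starProjection_le hQ hx hx0)
        (angle_starProjection_le hR hQx (norm_pos_iff.1 hy)))
  have h2 : Real.cos (a + b) ≤ Real.cos (InnerProductGeometry.angle x (R (Q x))) :=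
    Real.cos_le_cos_of_nonneg_of_le_pi (InnerProductGeometry.angle_nonneg _ _) (by linarith) h1
  -- Self-adjointness and idempotence of `R` replace `x` by `R x` in the inner product; then
  -- Cauchy–Schwarz applies.
  have h3 : Real.cos (InnerProductGeometry.angle x (R (Q x))) * (‖x‖ * ‖R (Q x)‖)
      ≤ ‖R x‖ * ‖R (Q x)‖ := by
    rw [InnerProductGeometry.cos_angle_mul_norm_mul_norm]
    change (inner ℂ x (R (Q x))).re ≤ _
    rw [← starProjection_apply_apply hR, inner_starProjection_right hR,
      starProjection_apply_apply hR]
    exact re_inner_le_norm (𝕜 := ℂ) _ _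
  have h4 : Real.cos (a + b) * ‖x‖ ≤ ‖R x‖ := by
    refine le_of_mul_le_mul_right ?_ hz
    calc Real.cos (a + b) * ‖x‖ * ‖R (Q x)‖ = Real.cos (a + b) * (‖x‖ * ‖R (Q x)‖) := by ring
      _ ≤ _ := (mul_le_mul_of_nonneg_right h2 (by positivity)).trans h3
  have h5 : 0 ≤ Real.cos (a + b) := Real.cos_nonneg_of_mem_Icc ⟨by linarith, by linarith⟩
  have h6 : 0 ≤ Real.sin (a + b) := Real.sin_nonneg_of_nonneg_of_le_pi (by linarith) (by linarith)
  apply le_of_sq_le_sq _ (by positivity)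
  rw [norm_sq_sub_starProjection hR, mul_pow, Real.sin_sq]
  have : (Real.cos (a + b) * ‖x‖) ^ 2 ≤ ‖R x‖ ^ 2 := by gcongr
  linarith [mul_pow (Real.cos (a + b)) ‖x‖ 2]

end Angle

/-! ### Triangle inequality for the maximal angle -/

variable {E : Type*} [NormedAddCommGroup E] [InnerProductSpace ℂ E] [CompleteSpace E]

/-- `(P - R) x = P (1 - R) x - (1 - P) R x` is an orthogonal decomposition, and `‖(1 - R) x‖² + ‖R
x‖² = ‖x‖²`. The first term is bounded through the adjoint `(1 - R) P`. -/
theorem norm_sub_le_of_starProjection {P R : E →L[ℂ] E} (hP : IsStarProjection P)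
    (hR : IsStarProjection R) {c : ℝ} (hc : 0 ≤ c)
    (h1 : ∀ x, P x = x → ‖x - R x‖ ≤ c * ‖x‖) (h2 : ∀ x, R x = x → ‖x - P x‖ ≤ c * ‖x‖) :
    ‖P - R‖ ≤ c := by
  have hcontr : ∀ x, ‖P x‖ ≤ ‖x‖ := fun x => by
    have := norm_sq_sub_starProjection hP x
    exact le_of_sq_le_sq (by nlinarith [sq_nonneg ‖x - P x‖]) (norm_nonneg _)
  have h3 : ‖(1 - R) * P‖ ≤ c := by
    refine ContinuousLinearMap.opNorm_le_bound _ hc fun x => ?_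
    exact (h1 (P x) (starProjection_apply_apply hP x)).trans
      (mul_le_mul_of_nonneg_left (hcontr x) hc)
  have h4 : ‖P * (1 - R)‖ ≤ c := by
    rw [← norm_star, star_mul, star_sub, star_one, hP.isSelfAdjoint.star_eq,
      hR.isSelfAdjoint.star_eq]
    exact h3
  refine ContinuousLinearMap.opNorm_le_bound _ hc fun x => ?_
  -- As `1 - R` is idempotent, the operator bound may be applied to `x - R x` in place of `x`; the
  -- squares can then add up to `c² ‖x‖²`.
  have h5 : ‖P (x - R x)‖ ≤ c * ‖x - R x‖ := by
    have := (P * (1 - R)).le_of_opNorm_le h4 (x - R x)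
    have e : (P * (1 - R)) (x - R x) = P (x - R x) := by
      change P ((x - R x) - R (x - R x)) = _
      rw [map_sub R, starProjection_apply_apply hR, sub_self, sub_zero]
    rwa [e] at this
  have h6 := h2 (R x) (starProjection_apply_apply hR x)
  have h7 : (P - R) x = P (x - R x) - (R x - P (R x)) := by
    rw [sub_apply, map_sub]; abel
  have h8 : inner ℂ (P (x - R x)) (R x - P (R x)) = 0 := by
    rw [← inner_starProjection_right hP, map_sub, starProjection_apply_apply hP, sub_self,
      inner_zero_right]
  have h9 : ‖(P - R) x‖ ^ 2 = ‖P (x - R x)‖ ^ 2 + ‖R x - P (R x)‖ ^ 2 := by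
    rw [h7, norm_sub_sq (𝕜 := ℂ), h8]; simp
  apply le_of_sq_le_sq _ (by positivity)
  rw [h9]
  have h10 : ‖P (x - R x)‖ ^ 2 ≤ (c * ‖x - R x‖) ^ 2 := by gcongr
  have h11 : ‖R x - P (R x)‖ ^ 2 ≤ (c * ‖R x‖) ^ 2 := by gcongr
  rw [mul_pow, norm_sq_sub_starProjection hR] at h10
  linarith [mul_pow c ‖R x‖ 2, mul_pow c ‖x‖ 2]

/-- The triangle inequality for the maximal angle between closed subspaces. -/
theorem arcsin_norm_sub_le_add {P Q R : E →L[ℂ] E} (hP : IsStarProjection P)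
    (hQ : IsStarProjection Q) (hR : IsStarProjection R) :
    Real.arcsin ‖P - R‖ ≤ Real.arcsin ‖P - Q‖ + Real.arcsin ‖Q - R‖ := by
  rcases lt_or_ge (Real.arcsin ‖P - Q‖ + Real.arcsin ‖Q - R‖) (Real.pi / 2) with h | h
  swap
  · exact (Real.arcsin_le_pi_div_two _).trans h
  have ha0 : 0 ≤ Real.arcsin ‖P - Q‖ := Real.arcsin_nonneg.2 (norm_nonneg _)
  have hb0 : 0 ≤ Real.arcsin ‖Q - R‖ := Real.arcsin_nonneg.2 (norm_nonneg _)
  have hpi := Real.pi_pos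
  -- The sum is below `π / 2`, so the claim is equivalent to a norm bound by its sine.
  rw [Real.arcsin_le_iff_le_sin' ⟨by linarith, h⟩]
  refine norm_sub_le_of_starProjection hP hR
    (Real.sin_nonneg_of_nonneg_of_le_pi (by linarith) (by linarith))
    (fun x hx => norm_sub_starProjection_le_sin hQ hR h hx) (fun x hx => ?_)
  have h' : Real.arcsin ‖R - Q‖ + Real.arcsin ‖Q - P‖ =
      Real.arcsin ‖P - Q‖ + Real.arcsin ‖Q - R‖ := by
    rw [norm_sub_rev R, norm_sub_rev Q P, add_comm]
  rw [← h']
  exact norm_sub_starProjection_le_sin hQ hP (h' ▸ h) hx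

/-! ### Lipschitz continuity of the evolved projection -/

theorem norm_propagator_apply {H : E →ₗ.[ℂ] E} (hH : IsSelfAdjoint H) (t : ℝ) (f : E) :
    ‖propagator H hH t f‖ = ‖f‖ :=
  ContinuousLinearMap.norm_map_of_mem_unitary ((isUnitaryGroupOf_propagator hH).mem_unitary t) f

/-- A product rule for a group that is only strongly continuous. The slope is `U s (slope of u)`
plus the slope of `s ↦ U s (u t)`; the first term converges because each `U s` is isometric, so only
the point `u t` must lie in the domain. -/
theorem hasDerivAt_propagator_apply {H : E →ₗ.[ℂ] E} (hH : IsSelfAdjoint H) {u : ℝ → E}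
    {u' g : E} {t : ℝ} (hu : HasDerivAt u u' t) (hg : (u t, g) ∈ H.graph) :
    HasDerivAt (fun s => propagator H hH s (u s))
      (propagator H hH t (u' - Complex.I • g)) t := by
  have hU := isUnitaryGroupOf_propagator hH
  have h1 := (hU.hasDerivAt hg t).2
  rw [hasDerivAt_iff_tendsto_slope] at hu h1 ⊢
  have h2 : Tendsto (fun s => propagator H hH s (slope u t s)) (𝓝[≠] t)
      (𝓝 (propagator H hH t u')) := by
    have h3 : Tendsto (fun s => propagator H hH s u') (𝓝[≠] t) (𝓝 (propagator H hH t u')) :=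
      ((hU.continuous u').tendsto t).mono_left nhdsWithin_le_nhds
    have h4 : Tendsto (fun s => propagator H hH s (slope u t s - u')) (𝓝[≠] t) (𝓝 0) := by
      rw [tendsto_zero_iff_norm_tendsto_zero]
      simp only [norm_propagator_apply]
      rw [← tendsto_zero_iff_norm_tendsto_zero, ← sub_self u']
      exact hu.sub_const u'
    have h5 := h3.add h4
    rw [add_zero] at h5
    exact h5.congr fun s => by rw [← map_add, add_sub_cancel]
  have h6 := h2.add h1
  have e : propagator H hH t u' + -Complex.I • propagator H hH t g =
      propagator H hH t (u' - Complex.I • g) := by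
    rw [map_sub, map_smul, neg_smul, sub_eq_add_neg]
  rw [e] at h6
  refine h6.congr fun s => ?_
  simp only [slope, vsub_eq_sub]
  have h7 : propagator H hH s ((s - t)⁻¹ • (u s - u t)) =
      (s - t)⁻¹ • propagator H hH s (u s - u t) :=
    ((propagator H hH s).restrictScalars ℝ).map_smul _ _
  rw [h7, ← smul_add, map_sub]
  congr 1
  abel

theorem norm_evolvedProjection_sub_apply_le {H : E →ₗ.[ℂ] E} (hH : IsSelfAdjoint H)
    {P₀ : E →L[ℂ] E} (hdom : ∀ f ∈ H.domain, P₀ f ∈ H.domain)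
    (hbdd : BddAbove (unitValues (commutatorPMap H P₀))) (s t : ℝ) {f : E} (hf : f ∈ H.domain) :
    ‖evolvedProjection H hH P₀ t f - evolvedProjection H hH P₀ s f‖ ≤
      commutatorNorm H P₀ * |t - s| * ‖f‖ := by
  have hU := isUnitaryGroupOf_propagator hH
  have key : ∀ r, ∃ v, ‖v‖ ≤ commutatorNorm H P₀ * ‖f‖ ∧
      HasDerivAt (fun r => evolvedProjection H hH P₀ r f) v r := by
    intro r
    -- The group preserves the domain and commutes with `H` there, so `g = H w`; hence the
    -- derivative is the commutator at `w`, up to a unitary and a factor `-i`.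
    obtain ⟨h1, h2⟩ := hU.hasDerivAt (H.mem_graph ⟨f, hf⟩) (-r)
    set w := propagator H hH (-r) f with hw
    set g := propagator H hH (-r) (H ⟨f, hf⟩)
    obtain ⟨⟨w', hw'⟩, hw1, hw2⟩ := (LinearPMap.mem_graph_iff H).1 h1
    simp only at hw1 hw2
    subst hw1
    have h3 : HasDerivAt (fun r => propagator H hH (-r) f) (Complex.I • g) r := by
      have := h2.scomp r (hasDerivAt_neg r)
      simpa [Function.comp_def] using this
    have h4 : HasDerivAt (fun r => P₀ (propagator H hH (-r) f)) (P₀ (Complex.I • g)) r :=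
      (P₀.restrictScalars ℝ).hasFDerivAt.comp_hasDerivAt r h3
    have h5 := hasDerivAt_propagator_apply hH h4 (H.mem_graph ⟨_, hdom _ hw'⟩)
    refine ⟨_, ?_, h5⟩
    have h6 := norm_commutatorPMap_le hbdd ⟨w, hw', hdom _ hw'⟩
    rw [norm_propagator_apply, map_smul, ← smul_sub, norm_smul, Complex.norm_I, one_mul,
      norm_sub_rev, ← hw2]
    refine h6.trans_eq ?_
    change commutatorNorm H P₀ * ‖w‖ = _
    rw [hw, norm_propagator_apply]
  choose v hv hv' using key
  have := Convex.norm_image_sub_le_of_norm_hasDerivWithin_le (x := s) (y := t)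
    (s := Set.univ) (fun r _ => (hv' r).hasDerivWithinAt) (fun r _ => hv r) convex_univ
    trivial trivial
  rw [Real.norm_eq_abs] at this
  linarith

theorem norm_evolvedProjection_sub_le {H : E →ₗ.[ℂ] E} (hH : IsSelfAdjoint H)
    {P₀ : E →L[ℂ] E} (hdom : ∀ f ∈ H.domain, P₀ f ∈ H.domain)
    (hbdd : BddAbove (unitValues (commutatorPMap H P₀))) (s t : ℝ) :
    ‖evolvedProjection H hH P₀ t - evolvedProjection H hH P₀ s‖ ≤
      commutatorNorm H P₀ * |t - s| := by
  refine ContinuousLinearMap.opNorm_le_bound _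
    (mul_nonneg (commutatorNorm_nonneg H P₀) (abs_nonneg _)) fun x => ?_
  -- The bound is a closed condition on the vector, so it extends from the dense domain.
  refine hH.dense_domain.induction (P := fun x =>
    ‖(evolvedProjection H hH P₀ t - evolvedProjection H hH P₀ s) x‖ ≤
      commutatorNorm H P₀ * |t - s| * ‖x‖)
    (fun f hf => norm_evolvedProjection_sub_apply_le hH hdom hbdd s t hf) ?_ x
  exact isClosed_le (by fun_prop) (by fun_prop)

/-- A self-adjoint idempotent is the orthogonal projection onto its range. -/
theorem maximalAngle_evolvedSubspace (H : E →ₗ.[ℂ] E) (hH : IsSelfAdjoint H)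
    (P₀ : E →L[ℂ] E) (hP₀ : IsStarProjection P₀) (s t : ℝ) :
    maximalAngle (evolvedSubspace H hH P₀ hP₀ s) (evolvedSubspace H hH P₀ hP₀ t) =
      Real.arcsin ‖evolvedProjection H hH P₀ t - evolvedProjection H hH P₀ s‖ := by
  have key : ∀ t, (evolvedSubspace H hH P₀ hP₀ t).toSubmodule.starProjection =
      evolvedProjection H hH P₀ t := fun t => by
    obtain ⟨_, h⟩ := isStarProjection_iff_eq_starProjection_range.1
      (isStarProjection_evolvedProjection hH hP₀ t)
    exact h.symm
  rw [maximalAngle, key, key, norm_sub_rev]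

/-! ### Subdivision and passage to the limit -/

/-- A partition of `[s, t]` into `n` equal steps, with the triangle inequality for the angle. -/
theorem arcsin_norm_sub_le_nsmul {P : ℝ → E →L[ℂ] E} (hP : ∀ t, IsStarProjection (P t)) {V : ℝ}
    (hV : ∀ s t, ‖P t - P s‖ ≤ V * |t - s|) (s h : ℝ) (n : ℕ) :
    Real.arcsin ‖P (s + n * h) - P s‖ ≤ n * Real.arcsin (V * |h|) := by
  induction n with
  | zero => simp
  | succ n ih =>
    have h1 := arcsin_norm_sub_le_add (hP (s + (n + 1 : ℕ) * h)) (hP (s + n * h)) (hP s)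
    have h2 : Real.arcsin ‖P (s + (n + 1 : ℕ) * h) - P (s + n * h)‖ ≤ Real.arcsin (V * |h|) := by
      apply Real.monotone_arcsin
      refine (hV _ _).trans_eq ?_
      congr 2
      push_cast; ring
    push_cast at h1 h2 ⊢
    linarith

/-- These are difference quotients at 0 of `x ↦ arcsin (c x)`, whose derivative there is `c`, along
`x = 1 / n`. -/
theorem tendsto_mul_arcsin_div (c : ℝ) :
    Tendsto (fun n : ℕ => (n : ℝ) * Real.arcsin (c * (n : ℝ)⁻¹)) atTop (𝓝 c) := by
  have h1 : HasDerivAt (fun x => Real.arcsin (c * x)) c 0 := by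
    have h2 := Real.hasDerivAt_arcsin (x := c * 0) (by simp) (by simp)
    have h3 := h2.comp 0 ((hasDerivAt_id (0 : ℝ)).const_mul c)
    simpa [Function.comp_def] using h3
  have h4 : Tendsto (fun n : ℕ => (n : ℝ)⁻¹) atTop (𝓝[>] 0) :=
    tendsto_inv_atTop_nhdsGT_zero.comp tendsto_natCast_atTop_atTop
  have h5 := h1.tendsto_slope_zero_right.comp h4
  simpa [Function.comp_def] using h5

theorem arcsin_norm_sub_le_mul_abs_sub {P : ℝ → E →L[ℂ] E} (hP : ∀ t, IsStarProjection (P t))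
    {V : ℝ} (hV : ∀ s t, ‖P t - P s‖ ≤ V * |t - s|) (s t : ℝ) :
    Real.arcsin ‖P t - P s‖ ≤ V * |t - s| := by
  refine ge_of_tendsto (tendsto_mul_arcsin_div (V * |t - s|)) ?_
  -- For `n = 0` the step `(t - s) / n` would be 0 and the partition would not reach `t`.
  filter_upwards [eventually_ne_atTop 0] with n hn
  have hn' : (n : ℝ) ≠ 0 := Nat.cast_ne_zero.2 hn
  have h := arcsin_norm_sub_le_nsmul hP hV s ((t - s) * (n : ℝ)⁻¹) n
  have e : s + n * ((t - s) * (n : ℝ)⁻¹) = t := by field_simp; ring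
  rwa [e, abs_mul, abs_of_nonneg (a := (n : ℝ)⁻¹) (inv_nonneg.2 (Nat.cast_nonneg n)), ← mul_assoc] at h

end SubspaceEvolution

theorem theorem2 {E : Type*} [NormedAddCommGroup E] [InnerProductSpace ℂ E] [CompleteSpace E]
    (H : E →ₗ.[ℂ] E) (hH : IsSelfAdjoint H)
    (P₀ : E →L[ℂ] E) (hP₀ : IsStarProjection P₀)
    (hdom : ∀ f ∈ H.domain, P₀ f ∈ H.domain)
    (hbdd : BddAbove (unitValues (commutatorPMap H P₀))) :
    ∀ s t : ℝ,
      maximalAngle (evolvedSubspace H hH P₀ hP₀ s) (evolvedSubspace H hH P₀ hP₀ t) =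
          Real.arcsin ‖evolvedProjection H hH P₀ t - evolvedProjection H hH P₀ s‖ ∧
        maximalAngle (evolvedSubspace H hH P₀ hP₀ s) (evolvedSubspace H hH P₀ hP₀ t) ≤
          commutatorNorm H P₀ * |t - s| := by
  intro s t
  have h := maximalAngle_evolvedSubspace H hH P₀ hP₀ s t
  refine ⟨h, h ▸ ?_⟩
  exact arcsin_norm_sub_le_mul_abs_sub (isStarProjection_evolvedProjection hH hP₀)
    (norm_evolvedProjection_sub_le hH hdom hbdd) s t
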